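/- Let $\mathbb{G}$ be a second countable locally compact (Hausdorff) Abelian group. Let $\mathcal{M}(\mathbb{G})$ be the space of (possibly unbounded) complex Borel measures on $\mathbb{G}$, i.e. of linear functionals on $C_c(\mathbb{G})$ that are sup-norm bounded on the functions supported in $K$ for each compact $K$, with the vague topology (pointwise convergence on $C_c(\mathbb{G})$); $S(\Lambda)$ denotes the support of $\Lambda$. The measure $\Lambda$ is translation-bounded if $|\Lambda|(K+t)\le M$ for all $t\in\mathbb{G}$, for some compact $K$ with non-empty interior and some $M\ge 0$. The hull $X_\Lambda$ is the vague closure of $\{\Lambda*\delta_t : t\in\mathbb{G}\}$, and $\mathrm{RLI}(\Lambda)$ is the set of translation-bounded $\Lambda'$ with $X_{\Lambda'}=X_\Lambda$, with the vague topology. A set $S\subseteq\mathbb{G}$ is uniformly discrete if there is a non-empty open set no translate of which contains two points of $S$; it is a Meyer set if $S$ and $S-S$ are uniformly discrete and $S+K=\mathbb{G}$ for some compact $K$. A weighted Meyer set is a translation-bounded measure whose support is contained in a Meyer set. A cut-and-project scheme $(H,\Gamma,s_H)$ consists of a locally compact (Hausdorff) Abelian group $H$, a finitely generated subgroup $\Gamma\subseteq\mathbb{G}$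 and a morphism $s_H:\Gamma\to H$ with dense range whose graph $\mathcal{G}(s_H)=\{(s_H(t),t): t\in\Gamma\}$ is a discrete co-compact subgroup of $H\times\mathbb{G}$. For $V\subseteq H$ put $\mathfrak{P}_H(V)=\{t\in\Gamma : s_H(t)\in V\}$. The scheme is an irredundant representation of $S\subseteq\mathbb{G}$ if $S\subseteq\Gamma$, the closure $W$ of $s_H(S)$ in $H$ is compact, and $W+w=W$ holds for $w\in H$ only if $w=0$. Let $\Lambda$ be a weighted Meyer set, let $(H,\Gamma,s_H)$ be an irredundant representation of $S(\Lambda)$, and let $W$ be the closure of $s_H(S(\Lambda))$ in $H$. (i) For every $\Lambda'\in X_\Lambda$ there is $(w,t)\in H\times\mathbb{G}$ with $$S(\Lambda')\subseteq\mathfrak{P}_H(W-w)+t.\qquad(*)$$ Assume moreover $\Lambda\neq 0$. (ii) For $\Lambda'\in\mathrm{RLI}(\Lambda)$ the pair $(w,t)$ in $(*)$ is unique modulo $\mathcal{G}(s_H)$. (iii) There is a map $p:\mathrm{RLI}(\Lambda)\to(H\times\mathbb{G})/\mathcal{G}(s_H)$ such that $p(\Lambda')=[w,t]$ if and only if $(w,t)$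 satisfies $(*)$. It is continuous and $\mathbb{G}$-equivariant: for $\Lambda'\in\mathrm{RLI}(\Lambda)$ and $s\in\mathbb{G}$ one has $\Lambda'*\delta_s\in\mathrm{RLI}(\Lambda)$, and $p(\Lambda'*\delta_s)=[w,t+s]$ if $p(\Lambda')=[w,t]$. -/

import Mathlib

open Topology
open scoped CompactlySupported ENNReal NNReal Pointwise

noncomputable section

/-! ### Complex (possibly unbounded) Radon measures with the vague topology -/

/-- The space `M(G)` of (possibly unbounded) complex Borel measures on `G`, as the space of linear
functionals on `C_c(G, ℂ)` that are bounded for the supremum norm on the functions supported in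
`K`, for every compact set `K`. -/
structure ComplexRadonMeasure (G : Type*) [TopologicalSpace G] where
  /-- the integral against the measure -/
  integral : C_c(G, ℂ) →ₗ[ℂ] ℂ
  bounded_on_compact : ∀ K : Set G, IsCompact K → ∃ C : ℝ, ∀ (φ : C_c(G, ℂ)) (r : ℝ),
    tsupport φ ⊆ K → (∀ x, ‖φ x‖ ≤ r) → ‖integral φ‖ ≤ C * r

/-- The function `x ↦ φ (x + t)`. -/
def shiftTest {G : Type*} [TopologicalSpace G] [AddCommGroup G] [IsTopologicalAddGroup G]
    (t : G) (φ : C_c(G, ℂ)) : C_c(G, ℂ) where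
  toFun x := φ (x + t)
  continuous_toFun := φ.continuous.comp (continuous_add_const t)
  hasCompactSupport' := φ.hasCompactSupport'.comp_homeomorph (Homeomorph.addRight t)

namespace ComplexRadonMeasure

section Topological

variable {G : Type*} [TopologicalSpace G]

/-- The vague topology: the weakest one for which `Λ ↦ ∫ φ dΛ` is continuous for every
`φ ∈ C_c(G, ℂ)`. -/
instance vagueTopology : TopologicalSpace (ComplexRadonMeasure G) :=
  TopologicalSpace.induced (fun Λ (φ : C_c(G, ℂ)) => Λ.integral φ) inferInstance

/-- The value `|Λ|(U)` of the total variation on an open set `U`. -/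
def variationOpen (Λ : ComplexRadonMeasure G) (U : Set G) : ℝ≥0∞ :=
  ⨆ (φ : C_c(G, ℂ)) (_ : tsupport φ ⊆ U) (_ : ∀ x, ‖φ x‖ ≤ 1), ‖Λ.integral φ‖ₑ

/-- The value `|Λ|(A)` of the total variation on a set `A`, by outer regularity. -/
def variation (Λ : ComplexRadonMeasure G) (A : Set G) : ℝ≥0∞ :=
  ⨅ (U : Set G) (_ : IsOpen U) (_ : A ⊆ U), Λ.variationOpen U

/-- The support `S(Λ)`: the complement of the largest open set on which `Λ` vanishes. -/
def support (Λ : ComplexRadonMeasure G) : Set G :=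
  {x | ∀ U ∈ 𝓝 x, ∃ φ : C_c(G, ℂ), tsupport φ ⊆ U ∧ Λ.integral φ ≠ 0}

end Topological

section Group

variable {G : Type*} [TopologicalSpace G] [AddCommGroup G] [IsTopologicalAddGroup G]

/-- The measure `Λ * δ_t`, that is, `φ ↦ ∫ φ (s + t) dΛ(s)`. -/
def translate (t : G) (Λ : ComplexRadonMeasure G) : ComplexRadonMeasure G where
  integral :=
    { toFun := fun φ => Λ.integral (shiftTest t φ)
      map_add' := fun φ ψ => by
        rw [← map_add]; rfl
      map_smul' := fun c φ => by
        rw [RingHom.id_apply, ← map_smul]; rfl }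
  bounded_on_compact := by
    intro K hK
    obtain ⟨C, hC⟩ := Λ.bounded_on_compact ((Homeomorph.addRight t) ⁻¹' K)
      ((Homeomorph.addRight t).isCompact_preimage.2 hK)
    refine ⟨C, fun φ r hφ hr => hC (shiftTest t φ) r ?_ fun x => hr (x + t)⟩
    have h : tsupport (shiftTest t φ) = (Homeomorph.addRight t) ⁻¹' tsupport φ :=
      tsupport_comp_eq_preimage (φ : G → ℂ) (Homeomorph.addRight t)
    rw [h]
    exact Set.preimage_mono hφ

/-- `Λ` is translation-bounded: there are a compact set `K` with nonempty interior and a constant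
`M ≥ 0` with `|Λ|(K + t) ≤ M` for all `t`. -/
def IsTranslationBounded (Λ : ComplexRadonMeasure G) : Prop :=
  ∃ (K : Set G) (M : ℝ≥0), IsCompact K ∧ (interior K).Nonempty ∧
    ∀ t : G, Λ.variation ((fun x => x + t) '' K) ≤ M

/-- The hull `X_Λ`: the vague closure of the orbit of `Λ` under translations. -/
def hull (Λ : ComplexRadonMeasure G) : Set (ComplexRadonMeasure G) :=
  closure (Set.range fun t : G => Λ.translate t)

/-- The rubber local isomorphism class of `Λ`. -/
def RLI (Λ : ComplexRadonMeasure G) : Set (ComplexRadonMeasure G) :=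
  {Λ' | Λ'.IsTranslationBounded ∧ Λ'.hull = Λ.hull}

end Group

end ComplexRadonMeasure

/-! ### Meyer sets -/

section Meyer

variable {G : Type*} [TopologicalSpace G] [AddCommGroup G]

/-- Some nonempty open set has no translate that contains two points of `S`. -/
def IsUniformlyDiscrete (S : Set G) : Prop :=
  ∃ U : Set G, IsOpen U ∧ U.Nonempty ∧ ∀ t : G, (S ∩ (fun x => x + t) '' U).Subsingleton

/-- `S + K` is the whole group for some compact set `K`. -/
def IsRelativelyDense (S : Set G) : Prop :=
  ∃ K : Set G, IsCompact K ∧ S + K = Set.univ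

/-- A Meyer set: uniformly discrete, relatively dense, with uniformly discrete difference set. -/
def IsMeyerSet (S : Set G) : Prop :=
  IsUniformlyDiscrete S ∧ IsRelativelyDense S ∧ IsUniformlyDiscrete (S - S)

/-- A weighted Meyer set: a translation-bounded measure supported on a Meyer set. -/
def ComplexRadonMeasure.IsWeightedMeyerSet [IsTopologicalAddGroup G]
    (Λ : ComplexRadonMeasure G) : Prop :=
  Λ.IsTranslationBounded ∧ ∃ S : Set G, IsMeyerSet S ∧ Λ.support ⊆ S

end Meyer

/-! ### Cut and project schemes -/

section CutProject

variable {G H : Type*} [TopologicalSpace G] [AddCommGroup G] [TopologicalSpace H] [AddCommGroup H]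

/-- The graph `{(s(t), t) : t ∈ Γ}` of a morphism `s : Γ → H`, as a subgroup of `H × G`. -/
def starGraph (Γ : AddSubgroup G) (s : Γ →+ H) : AddSubgroup (H × G) :=
  (s.prod Γ.subtype).range

variable (G H) in
/-- A cut and project scheme `(H, Γ, s_H)` over `G`. -/
structure CutProjectScheme where
  /-- the structure group -/
  Γ : AddSubgroup G
  fg : Γ.FG
  /-- the star map `s_H` -/
  star : Γ →+ H
  denseRange_star : DenseRange star
  /-- the graph of the star map is discrete -/
  discrete : DiscreteTopology (starGraph Γ star)
  /-- the graph of the star map is co-compact -/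
  cocompact : CompactSpace ((H × G) ⧸ starGraph Γ star)

namespace CutProjectScheme

/-- The lattice `𝒢(s_H)` of `H × G`. -/
def lattice (P : CutProjectScheme G H) : AddSubgroup (H × G) :=
  starGraph P.Γ P.star

/-- The set `𝔓_H(V) = {t ∈ Γ : s_H(t) ∈ V}`. -/
def projectionSet (P : CutProjectScheme G H) (V : Set H) : Set G :=
  {t | ∃ ht : t ∈ P.Γ, P.star ⟨t, ht⟩ ∈ V}

/-- The closure of `s_H(S)` in `H`, for `S ⊆ Γ`. -/
def window (P : CutProjectScheme G H) (S : Set G) : Set H :=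
  closure (P.star '' {γ : P.Γ | (γ : G) ∈ S})

/-- `P` is a cut and project representation of `S`: `S ⊆ Γ` and `s_H(S)` is relatively compact. -/
def IsRepresentation (P : CutProjectScheme G H) (S : Set G) : Prop :=
  S ⊆ P.Γ ∧ IsCompact (P.window S)

/-- `P` is an irredundant cut and project representation of `S`: moreover no nonzero `w ∈ H`
satisfies `W + w = W`, where `W` is the closure of `s_H(S)`. -/
def IsIrredundantRepresentation (P : CutProjectScheme G H) (S : Set G) : Prop :=
  P.IsRepresentation S ∧ ∀ w : H, (fun x => x + w) '' P.window S = P.window S → w = 0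

/-- The inclusion `S ⊆ 𝔓_H(W - w) + t`. -/
def IsParameter (P : CutProjectScheme G H) (W : Set H) (S : Set G) (w : H) (t : G) : Prop :=
  S ⊆ (fun x => x + t) '' P.projectionSet ((fun x => x - w) '' W)

end CutProjectScheme

end CutProject

end

open Set Filter

namespace ComplexRadonMeasure

/-! ### Vague topology and supports -/

section Topological

variable {G : Type*} [TopologicalSpace G]

/-! Let `T = (H × G) / 𝒢(s_H)`, a compact group, `j x = [0, x]`, and let `C` be the image of `W ×
{0}` in `T`. The inclusion (*) says exactly that `q = [w, t]` satisfies `q - j x ∈ C` for all `x` in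
the support of `Λ'`. This relation between `Λ'` and `q` is translation-equivariant, and it is
vaguely closed (`isClosed_setOf_isTorusParameter`). Existence: `0` is a parameter of `Λ`, so `j t`
is one of its translate by `t`. Projection along the compact `T` is a closed map, hence every
element of the hull has a parameter (`exists_mem_of_mem_hull`). Uniqueness: a parameter of `Λ`
itself is `[u, 0]` with `W + u ⊆ W`; compactness gives equality and irredundancy gives `u = 0`. For
`Λ'` in the RLI class, `Λ` lies in the hull of `Λ'`, and the difference of two parameters is carried
along to `Λ`. Continuity of `p` is the closed graph theorem for a compact target. -/

theorem continuous_integral (φ : C_c(G, ℂ)) :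
    Continuous fun Λ : ComplexRadonMeasure G => Λ.integral φ :=
  (continuous_apply φ).comp continuous_induced_dom

theorem ext_integral {Λ Λ' : ComplexRadonMeasure G} (h : ∀ φ, Λ.integral φ = Λ'.integral φ) :
    Λ = Λ' := by
  cases Λ
  cases Λ'
  congr
  exact LinearMap.ext h

/-- The integral of a test function vanishes if its support does not meet the support of the
measure. -/
theorem integral_eq_zero_of_disjoint_support [LocallyCompactSpace G] [T2Space G]
    (Λ : ComplexRadonMeasure G) (φ : C_c(G, ℂ)) (h : Disjoint (tsupport φ) Λ.support) :
    Λ.integral φ = 0 := by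
  have hloc : ∀ x ∈ tsupport φ, ∃ U : Set G, IsOpen U ∧ x ∈ U ∧
      ∀ ψ : C_c(G, ℂ), tsupport ψ ⊆ U → Λ.integral ψ = 0 := by
    intro x hx
    have hxs : x ∉ Λ.support := disjoint_left.1 h hx
    simp only [support, mem_ofPred_eq, not_forall, not_exists, not_and, not_not] at hxs
    obtain ⟨U, hU, hψ⟩ := hxs
    exact ⟨interior U, isOpen_interior, mem_interior_iff_mem_nhds.2 hU,
      fun ψ hs => hψ ψ (hs.trans interior_subset)⟩
  choose! U hUo hxU hU using hloc
  obtain ⟨b, hb, hcov⟩ := φ.hasCompactSupport'.isCompact.elim_nhds_subcover U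
    fun x hx => (hUo x hx).mem_nhds (hxU x hx)
  let e := b.equivFin
  obtain ⟨f, hfs, hf1, -, -⟩ := exists_continuous_sum_one_of_isOpen_isCompact
    (s := fun i => U (e.symm i)) (fun i => hUo _ (hb _ (e.symm i).2))
    φ.hasCompactSupport'.isCompact (fun x hx => by
      obtain ⟨y, hy, hxy⟩ := mem_iUnion₂.1 (hcov hx)
      exact mem_iUnion.2 ⟨e ⟨y, hy⟩, by simpa using hxy⟩)
  -- A partition of unity on the support of `φ` splits `φ` into pieces, each supported in an open
  -- set on which `Λ` vanishes.
  let g : Fin b.card → C_c(G, ℂ) := fun i =>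
    { toFun := fun x => (f i x : ℂ) * φ x
      continuous_toFun := (Complex.continuous_ofReal.comp (f i).continuous).mul φ.continuous
      hasCompactSupport' := φ.hasCompactSupport'.mul_left }
  have hsum : φ = ∑ i, g i := by
    ext x
    rw [CompactlySupportedContinuousMap.sum_apply]
    change φ x = ∑ i, (f i x : ℂ) * φ x
    rw [← Finset.sum_mul]
    by_cases hx : x ∈ tsupport φ
    · have h1 := hf1 hx
      simp only [Finset.sum_apply, Pi.one_apply] at h1
      rw [← Complex.ofReal_sum, h1, Complex.ofReal_one, one_mul]
    · rw [image_eq_zero_of_notMem_tsupport hx, mul_zero]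
  rw [hsum, map_sum]
  refine Finset.sum_eq_zero fun i _ => hU _ (hb _ (e.symm i).2) _ ?_
  refine (closure_mono fun x hx => ?_).trans (hfs i)
  exact fun h0 => hx (by change (f i x : ℂ) * φ x = 0; rw [h0]; simp)

end Topological

/-! ### Translates, hulls and the RLI class -/

section Group

variable {G : Type*} [TopologicalSpace G] [AddCommGroup G] [IsTopologicalAddGroup G]

theorem translate_translate (s t : G) (Λ : ComplexRadonMeasure G) :
    (Λ.translate s).translate t = Λ.translate (s + t) := by
  refine ext_integral fun φ => ?_
  change Λ.integral (shiftTest s (shiftTest t φ)) = Λ.integral (shiftTest (s + t) φ)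
  congr 1
  ext x
  exact congrArg φ (add_assoc x s t)

theorem translate_zero (Λ : ComplexRadonMeasure G) : Λ.translate 0 = Λ := by
  refine ext_integral fun φ => ?_
  change Λ.integral (shiftTest 0 φ) = Λ.integral φ
  congr 1
  ext x
  exact congrArg φ (add_zero x)

theorem tsupport_shiftTest (t : G) (φ : C_c(G, ℂ)) :
    tsupport (shiftTest t φ) = (fun x => x + t) ⁻¹' tsupport φ :=
  tsupport_comp_eq_preimage (φ : G → ℂ) (Homeomorph.addRight t)

theorem sub_mem_support_of_mem_support_translate {Λ : ComplexRadonMeasure G} {t x : G}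
    (hx : x ∈ (Λ.translate t).support) : x - t ∈ Λ.support := by
  intro U hU
  obtain ⟨φ, hφ, h0⟩ := hx ((fun y => y - t) ⁻¹' U)
    ((continuous_id.sub continuous_const).continuousAt.preimage_mem_nhds hU)
  refine ⟨shiftTest t φ, ?_, h0⟩
  rw [tsupport_shiftTest]
  intro y hy
  simpa using hφ hy

theorem self_mem_hull (Λ : ComplexRadonMeasure G) : Λ ∈ Λ.hull :=
  subset_closure ⟨0, Λ.translate_zero⟩

theorem hull_translate (s : G) (Λ : ComplexRadonMeasure G) : (Λ.translate s).hull = Λ.hull := by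
  unfold hull
  congr 1
  ext Λ'
  constructor
  · rintro ⟨t, rfl⟩
    exact ⟨s + t, (Λ.translate_translate s t).symm⟩
  · rintro ⟨t, rfl⟩
    refine ⟨t - s, ?_⟩
    simp only [translate_translate, add_sub_cancel]

theorem variationOpen_translate_le (s : G) (Λ : ComplexRadonMeasure G) (U : Set G) :
    (Λ.translate s).variationOpen U ≤ Λ.variationOpen ((fun x => x + s) ⁻¹' U) := by
  refine iSup_le fun φ => iSup_le fun hφ => iSup_le fun h1 => ?_
  refine le_iSup_of_le (shiftTest s φ) (le_iSup_of_le ?_ (le_iSup_of_le ?_ le_rfl))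
  · rw [tsupport_shiftTest]
    exact preimage_mono hφ
  · exact fun x => h1 (x + s)

theorem variation_translate_le (s : G) (Λ : ComplexRadonMeasure G) (A : Set G) :
    (Λ.translate s).variation A ≤ Λ.variation ((fun x => x + s) ⁻¹' A) := by
  refine le_iInf fun U => le_iInf fun hU => le_iInf fun hA => ?_
  refine iInf_le_of_le ((fun x => x - s) ⁻¹' U)
    (iInf_le_of_le (hU.preimage (continuous_id.sub continuous_const)) (iInf_le_of_le ?_ ?_))
  · exact fun x hx => hA (by simpa using hx)
  · refine (variationOpen_translate_le s Λ _).trans_eq ?_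
    congr 1
    ext x
    simp

theorem IsTranslationBounded.translate {Λ : ComplexRadonMeasure G} (h : Λ.IsTranslationBounded)
    (s : G) : (Λ.translate s).IsTranslationBounded := by
  obtain ⟨K, M, hK, hi, hM⟩ := h
  refine ⟨K, M, hK, hi, fun t => (variation_translate_le s Λ _).trans ?_⟩
  have e : (fun x => x + s) ⁻¹' ((fun x => x + t) '' K) = (fun x => x + (t - s)) '' K := by
    ext x
    simp only [mem_preimage, mem_image]
    exact exists_congr fun y => and_congr_right fun _ => by
      rw [← add_sub_assoc, sub_eq_iff_eq_add]
  rw [e]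
  exact hM (t - s)

theorem translate_mem_RLI {Λ Λ' : ComplexRadonMeasure G} (h : Λ' ∈ Λ.RLI) (s : G) :
    Λ'.translate s ∈ Λ.RLI :=
  ⟨h.1.translate s, (Λ'.hull_translate s).trans h.2⟩

/-- If a closed relation with values in a compact space relates every translate of `Λ` to some
point, then it does so for every element of the hull. -/
theorem exists_mem_of_mem_hull {T : Type*} [TopologicalSpace T] [CompactSpace T]
    {R : Set (ComplexRadonMeasure G × T)} (hR : IsClosed R) {Λ Λ' : ComplexRadonMeasure G}
    (h : ∀ t, ∃ q, (Λ.translate t, q) ∈ R) (hΛ' : Λ' ∈ Λ.hull) : ∃ q, (Λ', q) ∈ R := by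
  have hcl : IsClosed (Prod.fst '' R) := isClosedMap_fst_of_compactSpace R hR
  have hsub : Λ.hull ⊆ Prod.fst '' R := by
    refine closure_minimal ?_ hcl
    rintro _ ⟨t, rfl⟩
    obtain ⟨q, hq⟩ := h t
    exact ⟨_, hq, rfl⟩
  obtain ⟨⟨_, q⟩, hq, rfl⟩ := hsub hΛ'
  exact ⟨q, hq⟩

end Group

end ComplexRadonMeasure

/-! ### Torus parameters as a closed relation -/

section Torus

variable {G T : Type*} [TopologicalSpace G] [AddCommGroup G] [AddCommGroup T]

/-- The point `q` of `T` satisfies `q ∈ j x + C` for every `x` in the support of `Λ`. -/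
def IsTorusParameter (j : G →+ T) (C : Set T) (Λ : ComplexRadonMeasure G) (q : T) : Prop :=
  ∀ x ∈ Λ.support, q - j x ∈ C

/-- Supports are lower semicontinuous: a support point `x` is witnessed by a test function near `x`
with nonzero integral. The integral stays nonzero for vaguely close measures, so these have support
points near `x`, and a violation at `x` persists. -/
theorem isClosed_setOf_isTorusParameter [LocallyCompactSpace G] [T2Space G]
    [TopologicalSpace T] [IsTopologicalAddGroup T] {j : G →+ T} (hj : Continuous j) {C : Set T} (hC : IsClosed C) :
    IsClosed {z : ComplexRadonMeasure G × T | IsTorusParameter j C z.1 z.2} := by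
  rw [← isOpen_compl_iff, isOpen_iff_mem_nhds]
  rintro ⟨Λ, q⟩ hz
  simp only [IsTorusParameter, mem_compl_iff, mem_ofPred_eq, not_forall] at hz
  obtain ⟨x, hx, hq⟩ := hz
  have hcont : Continuous fun z : T × G => z.1 - j z.2 :=
    continuous_fst.sub (hj.comp continuous_snd)
  have hN : {z : T × G | z.1 - j z.2 ∉ C} ∈ 𝓝 (q, x) :=
    (hC.isOpen_compl.preimage hcont).mem_nhds hq
  obtain ⟨N, hN, U, hU, hNU⟩ := mem_nhds_prod_iff.1 hN
  obtain ⟨φ, hφ, h0⟩ := hx U hU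
  have hO : {Λ' : ComplexRadonMeasure G | Λ'.integral φ ≠ 0} ∈ 𝓝 Λ :=
    (ComplexRadonMeasure.continuous_integral φ).continuousAt.eventually_ne h0
  filter_upwards [prod_mem_nhds hO hN] with ⟨Λ', q'⟩ ⟨h1, h2⟩ hpar
  obtain ⟨y, hy, hy'⟩ := not_disjoint_iff.1
    (mt (Λ'.integral_eq_zero_of_disjoint_support φ) h1)
  exact hNU (mk_mem_prod h2 (hφ hy)) (hpar y hy')

theorem IsTorusParameter.translate [IsTopologicalAddGroup G] {j : G →+ T} {C : Set T}
    {Λ : ComplexRadonMeasure G} {q : T} (h : IsTorusParameter j C Λ q) (t : G) :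
    IsTorusParameter j C (Λ.translate t) (q + j t) := by
  intro x hx
  have := h _ (ComplexRadonMeasure.sub_mem_support_of_mem_support_translate hx)
  rwa [map_sub, sub_sub_eq_add_sub] at this

end Torus

/-- A translate of a compact set that is contained in the set is equal to it. -/
theorem IsCompact.image_add_right_eq_of_subset {H : Type*} [AddCommGroup H] [TopologicalSpace H]
    [IsTopologicalAddGroup H] [T2Space H] {W : Set H} (hW : IsCompact W) {u : H}
    (h : (fun x => x + u) '' W ⊆ W) : (fun x => x + u) '' W = W := by
  refine h.antisymm fun w hw => ?_
  have hmem : ∀ n : ℕ, ∀ x ∈ W, x + n • u ∈ W := by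
    intro n
    induction n with
    | zero => simp
    | succ n ih =>
      intro x hx
      rw [succ_nsmul, ← add_assoc]
      exact h ⟨_, ih x hx, rfl⟩
  -- Two terms `w + n • u` and `w + m • u`, `n < m`, near a common cluster point make `(m - n) • u`
  -- small, so `w + (m - n) • u` is a point of `W + u` close to `w`.
  obtain ⟨c, -, hc⟩ := hW.exists_mapClusterPt (f := atTop) (u := fun n : ℕ => w + n • u)
    (tendsto_principal.2 (Eventually.of_forall fun n => hmem n w hw))
  have hcl : IsClosed ((fun x => x + u) '' W) :=
    (hW.image (continuous_id.add continuous_const)).isClosed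
  rw [← hcl.closure_eq, mem_closure_iff_nhds]
  intro V hV
  have hcont : Continuous fun z : H × H => w + (z.1 - z.2) :=
    continuous_const.add (continuous_fst.sub continuous_snd)
  have hV' : {z : H × H | w + (z.1 - z.2) ∈ V} ∈ 𝓝 (c, c) :=
    hcont.continuousAt.preimage_mem_nhds (by simpa using hV)
  obtain ⟨A, hA, B, hB, hAB⟩ := mem_nhds_prod_iff.1 hV'
  obtain ⟨n, hn⟩ := (hc.frequently hB).exists
  obtain ⟨m, hm, hnm⟩ := ((hc.frequently hA).and_eventually (eventually_gt_atTop n)).exists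
  obtain ⟨k, rfl⟩ := Nat.exists_eq_add_of_lt hnm
  refine ⟨_, hAB (mk_mem_prod hm hn), w + k • u, hmem k w hw, ?_⟩
  simp only [add_smul, one_smul]
  abel

/-! ### Cut and project schemes and their torus -/

namespace CutProjectScheme

variable {G H : Type*} [AddCommGroup G] [TopologicalSpace G] [AddCommGroup H] [TopologicalSpace H]

/-- The homomorphism `x ↦ [0, x]` of `G` into the torus `(H × G) / 𝒢(s_H)`. -/
def toTorus (P : CutProjectScheme G H) : G →+ (H × G) ⧸ P.lattice :=
  (QuotientAddGroup.mk' P.lattice).comp (AddMonoidHom.inr H G)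

/-- The image of `V × {0}` in the torus `(H × G) / 𝒢(s_H)`. -/
def torusWindow (P : CutProjectScheme G H) (V : Set H) : Set ((H × G) ⧸ P.lattice) :=
  (fun v : H => (QuotientAddGroup.mk (v, 0) : (H × G) ⧸ P.lattice)) '' V

theorem mem_lattice {P : CutProjectScheme G H} {v : H} {x : G} :
    (v, x) ∈ P.lattice ↔ ∃ hx : x ∈ P.Γ, P.star ⟨x, hx⟩ = v := by
  constructor
  · rintro ⟨γ, hγ⟩
    obtain ⟨rfl, rfl⟩ := Prod.mk.inj hγ
    exact ⟨γ.2, rfl⟩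
  · rintro ⟨hx, rfl⟩
    exact ⟨⟨x, hx⟩, rfl⟩

theorem continuous_toTorus (P : CutProjectScheme G H) : Continuous P.toTorus :=
  continuous_quot_mk.comp (continuous_const.prodMk continuous_id)

theorem isCompact_torusWindow (P : CutProjectScheme G H) {V : Set H} (hV : IsCompact V) :
    IsCompact (P.torusWindow V) :=
  hV.image (continuous_quot_mk.comp (continuous_id.prodMk continuous_const))

/-- The classes of `(w, t - x)` and `(v, 0)` agree iff `(v - w, x - t)` lies on the graph of the
star map. -/
theorem mk_sub_toTorus_mem_torusWindow {P : CutProjectScheme G H} {V : Set H} {w : H} {t x : G} :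
    (QuotientAddGroup.mk (w, t) : (H × G) ⧸ P.lattice) - P.toTorus x ∈ P.torusWindow V ↔
      ∃ hx : x - t ∈ P.Γ, P.star ⟨x - t, hx⟩ + w ∈ V := by
  have key : ∀ v : H, (QuotientAddGroup.mk (v, 0) : (H × G) ⧸ P.lattice) =
      QuotientAddGroup.mk (w, t) - P.toTorus x ↔
        ∃ hx : x - t ∈ P.Γ, P.star ⟨x - t, hx⟩ = v - w := by
    intro v
    have e : (QuotientAddGroup.mk (w, t) : (H × G) ⧸ P.lattice) - P.toTorus x =
        QuotientAddGroup.mk (w, t - x) := by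
      change QuotientAddGroup.mk ((w, t) - (0, x)) = _
      simp
    rw [e, eq_comm, QuotientAddGroup.eq, ← mem_lattice]
    have : -(w, t - x) + (v, 0) = (v - w, x - t) := by
      ext <;> simp; abel
    rw [this]
  constructor
  · rintro ⟨v, hv, he⟩
    obtain ⟨hx, hs⟩ := (key v).1 he
    exact ⟨hx, by rwa [hs, sub_add_cancel]⟩
  · rintro ⟨hx, hv⟩
    exact ⟨_, hv, (key _).2 ⟨hx, by rw [add_sub_cancel_right]⟩⟩

theorem isParameter_iff_isTorusParameter {P : CutProjectScheme G H} {W : Set H}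
    {Λ : ComplexRadonMeasure G} {w : H} {t : G} :
    P.IsParameter W Λ.support w t ↔
      IsTorusParameter P.toTorus (P.torusWindow W) Λ (QuotientAddGroup.mk (w, t)) := by
  refine forall₂_congr fun x _ => ?_
  rw [mk_sub_toTorus_mem_torusWindow]
  constructor
  · rintro ⟨y, ⟨hy, v, hv, hs⟩, rfl⟩
    simp only [add_sub_cancel_right]
    exact ⟨hy, by rwa [← hs, sub_add_cancel]⟩
  · rintro ⟨hx, hv⟩
    exact ⟨x - t, ⟨hx, _, hv, add_sub_cancel_right _ _⟩, sub_add_cancel x t⟩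

theorem isTorusParameter_zero {P : CutProjectScheme G H} {Λ : ComplexRadonMeasure G}
    (hP : P.IsRepresentation Λ.support) :
    IsTorusParameter P.toTorus (P.torusWindow (P.window Λ.support)) Λ 0 := by
  intro x hx
  refine mk_sub_toTorus_mem_torusWindow.2 ⟨by simpa using hP.1 hx, ?_⟩
  rw [add_zero]
  exact subset_closure ⟨_, by simpa using hx, rfl⟩

theorem eq_zero_of_isTorusParameter [IsTopologicalAddGroup H] [T2Space H]
    {P : CutProjectScheme G H} {Λ : ComplexRadonMeasure G}
    (hP : P.IsIrredundantRepresentation Λ.support) (hne : Λ.support.Nonempty)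
    {q : (H × G) ⧸ P.lattice}
    (hq : IsTorusParameter P.toTorus (P.torusWindow (P.window Λ.support)) Λ q) : q = 0 := by
  obtain ⟨x₀, hx₀⟩ := hne
  -- A single support point `x₀` gives `q = [v, x₀]`, and subtracting the lattice point `(P.star x₀,
  -- x₀)` clears the second coordinate.
  obtain ⟨u, rfl⟩ : ∃ u : H, q = QuotientAddGroup.mk (u, 0) := by
    obtain ⟨v, -, hv⟩ := hq x₀ hx₀
    refine ⟨v - P.star ⟨x₀, hP.1.1 hx₀⟩, ?_⟩
    rw [← sub_add_cancel q (P.toTorus x₀), ← hv]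
    change (QuotientAddGroup.mk ((v, 0) + (0, x₀)) : (H × G) ⧸ P.lattice) = _
    rw [eq_comm, QuotientAddGroup.eq]
    convert mem_lattice.2 ⟨hP.1.1 hx₀, rfl⟩ using 1
    ext <;> simp
  have hsub : (fun x => x + u) '' P.window Λ.support ⊆ P.window Λ.support := by
    rw [image_subset_iff]
    refine closure_minimal ?_ (isClosed_closure.preimage (continuous_id.add continuous_const))
    rintro _ ⟨γ, hγ, rfl⟩
    obtain ⟨hx, hv⟩ := mk_sub_toTorus_mem_torusWindow.1 (hq γ hγ)
    simp only [sub_zero] at hv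
    exact hv
  rw [hP.2 u (hP.1.2.image_add_right_eq_of_subset hsub)]
  rfl

/-- Each translate of `Λ'` by `t` has the parameters `q + j t` and `q' + j t`, with one common
shift. In the limit `Λ` has parameters `q + r` and `q' + r`, and both must be `0`. -/
theorem isTorusParameter_unique [IsTopologicalAddGroup G] [LocallyCompactSpace G] [T2Space G]
    [IsTopologicalAddGroup H] [T2Space H] {P : CutProjectScheme G H} {Λ Λ' : ComplexRadonMeasure G}
    (hP : P.IsIrredundantRepresentation Λ.support) (hne : Λ.support.Nonempty)
    (hC : IsClosed (P.torusWindow (P.window Λ.support))) (hΛ : Λ ∈ Λ'.hull)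
    {q q' : (H × G) ⧸ P.lattice}
    (hq : IsTorusParameter P.toTorus (P.torusWindow (P.window Λ.support)) Λ' q)
    (hq' : IsTorusParameter P.toTorus (P.torusWindow (P.window Λ.support)) Λ' q') : q = q' := by
  have : CompactSpace ((H × G) ⧸ P.lattice) := P.cocompact
  have hR := isClosed_setOf_isTorusParameter P.continuous_toTorus hC
  have hcont : ∀ a : (H × G) ⧸ P.lattice,
      Continuous fun z : ComplexRadonMeasure G × ((H × G) ⧸ P.lattice) => (z.1, a + z.2) :=
    fun a => continuous_fst.prodMk (continuous_const.add continuous_snd)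
  obtain ⟨r, hr, hr'⟩ := ComplexRadonMeasure.exists_mem_of_mem_hull
    ((hR.preimage (hcont q)).inter (hR.preimage (hcont q')))
    (fun t => ⟨P.toTorus t, hq.translate t, hq'.translate t⟩) hΛ
  have h := eq_zero_of_isTorusParameter hP hne hr
  have h' := eq_zero_of_isTorusParameter hP hne hr'
  exact add_right_cancel (h.trans h'.symm)

end CutProjectScheme

theorem theorem5p5 {G H : Type*}
    [AddCommGroup G] [TopologicalSpace G] [IsTopologicalAddGroup G]
    [LocallyCompactSpace G] [T2Space G] [SecondCountableTopology G]
    [AddCommGroup H] [TopologicalSpace H] [IsTopologicalAddGroup H]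
    [LocallyCompactSpace H] [T2Space H]
    (Λ : ComplexRadonMeasure G) (hΛ : Λ.IsWeightedMeyerSet)
    (P : CutProjectScheme G H) (hP : P.IsIrredundantRepresentation Λ.support)
    (W : Set H) (hW : W = P.window Λ.support) :
    -- (i)
    (∀ Λ' ∈ Λ.hull, ∃ (w : H) (t : G), P.IsParameter W Λ'.support w t) ∧
    -- (ii)
    (Λ.support.Nonempty → ∀ Λ' ∈ Λ.RLI, ∀ (w w' : H) (t t' : G),
      P.IsParameter W Λ'.support w t → P.IsParameter W Λ'.support w' t' →
        (w, t) - (w', t') ∈ P.lattice) ∧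
    -- (iii)
    (Λ.support.Nonempty → ∃ p : Λ.RLI → (H × G) ⧸ P.lattice,
      (∀ (Λ' : Λ.RLI) (w : H) (t : G),
        p Λ' = QuotientAddGroup.mk (w, t) ↔ P.IsParameter W Λ'.1.support w t) ∧
      Continuous p ∧
      ∀ (Λ' : Λ.RLI) (s : G), ∃ h : Λ'.1.translate s ∈ Λ.RLI,
        p ⟨Λ'.1.translate s, h⟩ = p Λ' + QuotientAddGroup.mk (0, s)) := by
  subst hW
  set W := P.window Λ.support
  have : DiscreteTopology P.lattice := P.discrete
  have : CompactSpace ((H × G) ⧸ P.lattice) := P.cocompact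
  -- A closed lattice makes the torus Hausdorff, so the compact image of `W` is closed.
  have : IsClosed (P.lattice : Set (H × G)) := AddSubgroup.isClosed_of_discrete
  have hC : IsClosed (P.torusWindow W) := (P.isCompact_torusWindow hP.1.2).isClosed
  have hR := isClosed_setOf_isTorusParameter P.continuous_toTorus hC
  have hex : ∀ Λ' ∈ Λ.hull, ∃ q, IsTorusParameter P.toTorus (P.torusWindow W) Λ' q :=
    fun Λ' hΛ' => ComplexRadonMeasure.exists_mem_of_mem_hull hR
      (fun t => ⟨_, (CutProjectScheme.isTorusParameter_zero hP.1).translate t⟩) hΛ'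
  have huniq : Λ.support.Nonempty → ∀ Λ' ∈ Λ.RLI, ∀ q q',
      IsTorusParameter P.toTorus (P.torusWindow W) Λ' q →
      IsTorusParameter P.toTorus (P.torusWindow W) Λ' q' → q = q' :=
    fun hne Λ' hΛ' _ _ => CutProjectScheme.isTorusParameter_unique hP hne hC
      (hΛ'.2.symm ▸ Λ.self_mem_hull)
  refine ⟨fun Λ' hΛ' => ?_, fun hne Λ' hΛ' w w' t t' h h' => ?_, fun hne => ?_⟩
  · obtain ⟨q, hq⟩ := hex Λ' hΛ'
    obtain ⟨⟨w, t⟩, rfl⟩ := QuotientAddGroup.mk_surjective q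
    exact ⟨w, t, CutProjectScheme.isParameter_iff_isTorusParameter.2 hq⟩
  · have e := huniq hne Λ' hΛ' _ _ (CutProjectScheme.isParameter_iff_isTorusParameter.1 h)
      (CutProjectScheme.isParameter_iff_isTorusParameter.1 h')
    have e' := QuotientAddGroup.eq.1 e.symm
    rwa [neg_add_eq_sub] at e'
  · choose p hp using fun Λ' : Λ.RLI => hex Λ'.1 (Λ'.2.2 ▸ Λ'.1.self_mem_hull)
    have hp_iff : ∀ (Λ' : Λ.RLI) q, p Λ' = q ↔
        IsTorusParameter P.toTorus (P.torusWindow W) Λ'.1 q :=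
      fun Λ' q => ⟨fun h => h ▸ hp Λ', huniq hne Λ'.1 Λ'.2 _ _ (hp Λ')⟩
    refine ⟨p, fun Λ' w t => ?_, ?_, fun Λ' s => ?_⟩
    · rw [hp_iff, CutProjectScheme.isParameter_iff_isTorusParameter]
    · refine continuous_iff_isClosed.2 fun F hF => ?_
      -- By uniqueness `p ⁻¹' F` is the projection of the closed set of pairs `(Λ', q)` with `q ∈ F`
      -- a parameter of `Λ'`.
      have hcl := isClosedMap_fst_of_compactSpace _
        ((hR.preimage (continuous_subtype_val.prodMap continuous_id)).inter
          (hF.preimage (continuous_snd (X := Λ.RLI))))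
      convert hcl using 1
      ext Λ'
      constructor
      · exact fun h => ⟨(Λ', p Λ'), ⟨hp Λ', h⟩, rfl⟩
      · rintro ⟨⟨Λ'', q⟩, ⟨h1, h2⟩, rfl⟩
        rw [mem_preimage, (hp_iff Λ'' q).2 h1]
        exact h2
    · exact ⟨ComplexRadonMeasure.translate_mem_RLI Λ'.2 s, (hp_iff _ _).2 ((hp Λ').translate s)⟩
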